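/- Let $\omega:[0,\infty)\to[0,\infty)$ be a weight function, i.e. a continuous increasing (not necessarily strictly) function such that $(\alpha)$ there is $L\ge 1$ with $\omega(2t)\le L(\omega(t)+1)$ for all $t\ge 0$; $(\beta)$ $\int_0^\infty \frac{\omega(t)}{1+t^2}\,dt<\infty$; $(\gamma)$ $\log(1+t^2)=o(\omega(t))$ as $t\to\infty$; $(\delta)$ $\varphi_\omega:t\mapsto\omega(e^t)$ is convex on $\mathbb{R}$. Put $\varphi_\omega^*(s)=\sup_{t\ge 0}\,(st-\varphi_\omega(t))$ for $s\ge 0$. Let $\mathcal S_\omega(\mathbb R)$ be the space of all $f\in C^\infty(\mathbb R)$ (complex valued) with $$p_{\omega,\lambda}(f)=\sup_{x\in\mathbb R}\ \sup_{n,q\in\mathbb N_0}(1+|x|)^q\,|f^{(n)}(x)|\,\exp\Bigl(-\lambda\varphi_\omega^*\bigl(\tfrac{n+q}{\lambda}\bigr)\Bigr)<\infty\quad\text{for every }\lambda>0,$$ with the locally convex topology generated by the norms $p_{\omega,\lambda}$, $\lambda>0$, and let $\mathcal S(\mathbb R)$ be the Schwartz space. Suppose that $\omega$ satisfies condition $(\zeta)$: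 there is $H\ge 1$ with $2\omega(t)\le\omega(Ht)+H$ for all $t\ge 0$. Let $a\in\mathbb R$, $a\ne 0$, $\psi(x)=ax$, let $\psi_m$ be the $m$-th iterate of $\psi$, and let $C_\psi f=f\circ\psi$. Then the following conditions are equivalent. 1. $C_\psi:\mathcal S_\omega(\mathbb R)\to\mathcal S_\omega(\mathbb R)$ is power bounded, i.e. the sequence $(C_\psi^k)_{k\ge 1}$ is equicontinuous. 2. $C_\psi:\mathcal S_\omega(\mathbb R)\to\mathcal S_\omega(\mathbb R)$ is $m$-topologizable, i.e. for every continuous seminorm $p$ on $\mathcal S_\omega(\mathbb R)$ there are a continuous seminorm $q$ and $C\ge 1$ such that $p(C_\psi^k f)\le C^k q(f)$ for all $k\ge 1$ and all $f$. 3. $C_\psi:\mathcal S_\omega(\mathbb R)\to\mathcal S_\omega(\mathbb R)$ is topologizable, i.e. for every continuous seminorm $p$ on $\mathcal S_\omega(\mathbb R)$ there is a continuous seminorm $q$ such that for every $k\ge 1$ there is $M_k>0$ with $p(C_\psi^k f)\le M_k\,q(f)$ for all $f$. 4. The family $\{C_{\psi_m}:\mathcal S_\omega(\mathbb R)\to\mathcal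 S(\mathbb R):m\ge 1\}$ is equicontinuous. 5. $a=1$ or $a=-1$. -/

import Mathlib

open Set Filter Topology MeasureTheory Asymptotics
open scoped SchwartzMap

noncomputable section

/-- A (non-quasianalytic) weight function `ω : [0, ∞) → [0, ∞)` in the sense of Braun, Meise and
Taylor. The function is given on all of `ℝ`, but only its values on `[0, ∞)` are constrained and
only these are ever used. "Increasing" is meant in the wide sense, as for `max 0 (log t) ^ p`. -/
structure IsWeightFunction (ω : ℝ → ℝ) : Prop where
  continuousOn : ContinuousOn ω (Ici 0)
  monotoneOn : MonotoneOn ω (Ici 0)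
  nonneg : ∀ t, 0 ≤ t → 0 ≤ ω t
  /-- condition (α) -/
  alpha : ∃ L : ℝ, 1 ≤ L ∧ ∀ t, 0 ≤ t → ω (2 * t) ≤ L * (ω t + 1)
  /-- condition (β) -/
  beta : IntegrableOn (fun t : ℝ => ω t / (1 + t ^ 2)) (Ioi 0) volume
  /-- condition (γ) -/
  gamma : (fun t : ℝ => Real.log (1 + t ^ 2)) =o[atTop] ω
  /-- condition (δ) -/
  delta : ConvexOn ℝ univ (fun t : ℝ => ω (Real.exp t))

/-- Condition (ζ): `2 ω(t) ≤ ω(H t) + H` for all `t ≥ 0` and some `H ≥ 1`. -/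
def ConditionZeta (ω : ℝ → ℝ) : Prop :=
  ∃ H : ℝ, 1 ≤ H ∧ ∀ t, 0 ≤ t → 2 * ω t ≤ ω (H * t) + H

/-- The Young conjugate `φ_ω^*(s) = sup {s t - φ_ω(t) : t ≥ 0}` of `φ_ω(t) = ω(e^t)`. -/
def youngConj (ω : ℝ → ℝ) (s : ℝ) : ℝ :=
  sSup ((fun t : ℝ => s * t - ω (Real.exp t)) '' Ici 0)

/-- For a weight function the supremum that defines the Young conjugate is finite. -/
theorem IsWeightFunction.bddAbove_youngConj {ω : ℝ → ℝ} (hω : IsWeightFunction ω) (s : ℝ) :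
    BddAbove ((fun t : ℝ => s * t - ω (Real.exp t)) '' Ici 0) := by
  have hc : (0 : ℝ) < (|s| + 1)⁻¹ := by positivity
  have h1 := (hω.gamma.bound hc)
  obtain ⟨T, hT⟩ := eventually_atTop.1 h1
  set R : ℝ := max T 1
  refine ⟨|s| * Real.log R, ?_⟩
  rintro _ ⟨t, ht, rfl⟩
  have ht : 0 ≤ t := ht
  have hR : 1 ≤ R := le_max_right _ _
  have hs : s * t ≤ |s| * t := mul_le_mul_of_nonneg_right (le_abs_self s) ht
  have hω0 : 0 ≤ ω (Real.exp t) := hω.nonneg _ (Real.exp_pos t).le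
  have hlogR : 0 ≤ Real.log R := Real.log_nonneg hR
  change s * t - ω (Real.exp t) ≤ _
  rcases le_total (Real.exp t) R with h | h
  · have : t ≤ Real.log R := (Real.le_log_iff_exp_le (by linarith)).2 h
    have := mul_le_mul_of_nonneg_left this (abs_nonneg s)
    linarith
  · have h2 := hT (Real.exp t) ((le_max_left _ _).trans h)
    rw [Real.norm_of_nonneg hω0] at h2
    have h3 : t ≤ ‖Real.log (1 + Real.exp t ^ 2)‖ := by
      refine le_trans ?_ (Real.le_norm_self _)
      rw [Real.le_log_iff_exp_le (by positivity)]
      nlinarith [sq_nonneg (Real.exp t - 1), Real.exp_pos t]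
    have h4 : (|s| + 1) * t ≤ ω (Real.exp t) := by
      have := mul_le_mul_of_nonneg_left (h3.trans h2) (by positivity : 0 ≤ |s| + 1)
      rwa [← mul_assoc, mul_inv_cancel₀ (by positivity), one_mul] at this
    nlinarith [mul_nonneg (abs_nonneg s) hlogR]

/-- The quantity `(1 + |x|)^q |f^(n)(x)| exp(-l φ_ω^*((n + q) / l))` at `i = (x, n, q)`. -/
def gsTerm (ω : ℝ → ℝ) (l : ℝ) (f : ℝ → ℂ) (i : ℝ × ℕ × ℕ) : ℝ :=
  (1 + |i.1|) ^ i.2.2 * ‖iteratedDeriv i.2.1 f i.1‖ *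
    Real.exp (-(l * youngConj ω (((i.2.1 + i.2.2 : ℕ) : ℝ) / l)))

theorem gsTerm_nonneg (ω : ℝ → ℝ) (l : ℝ) (f : ℝ → ℂ) (i : ℝ × ℕ × ℕ) :
    0 ≤ gsTerm ω l f i := by
  unfold gsTerm; positivity

theorem gsTerm_add_le (ω : ℝ → ℝ) (l : ℝ) {f g : ℝ → ℂ} (hf : ContDiff ℝ (⊤ : ℕ∞) f)
    (hg : ContDiff ℝ (⊤ : ℕ∞) g) (i : ℝ × ℕ × ℕ) :
    gsTerm ω l (f + g) i ≤ gsTerm ω l f i + gsTerm ω l g i := by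
  unfold gsTerm
  rw [iteratedDeriv_add (hf.contDiffAt.of_le (by exact_mod_cast le_top))
    (hg.contDiffAt.of_le (by exact_mod_cast le_top)), ← add_mul, ← mul_add]
  gcongr
  exact norm_add_le _ _

theorem gsTerm_smul (ω : ℝ → ℝ) (l : ℝ) {f : ℝ → ℂ} (c : ℂ) (hf : ContDiff ℝ (⊤ : ℕ∞) f)
    (i : ℝ × ℕ × ℕ) : gsTerm ω l (c • f) i = ‖c‖ * gsTerm ω l f i := by
  unfold gsTerm
  rw [iteratedDeriv_const_smul (hf.contDiffAt.of_le (by exact_mod_cast le_top)) c, norm_smul]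
  ring

theorem gsTerm_zero (ω : ℝ → ℝ) (l : ℝ) (i : ℝ × ℕ × ℕ) : gsTerm ω l 0 i = 0 := by
  have h := gsTerm_smul ω l (f := 0) 0 contDiff_const i
  simpa using h

/-- The smooth functions `f : ℝ → ℂ` with `p_{ω, l}(f) < ∞` for every `l > 0`, as a vector space. -/
def gelfandShilovSubmodule (ω : ℝ → ℝ) : Submodule ℂ (ℝ → ℂ) where
  carrier := {f | ContDiff ℝ (⊤ : ℕ∞) f ∧ ∀ l : ℝ, 0 < l → BddAbove (range (gsTerm ω l f))}
  zero_mem' := ⟨contDiff_const, fun l _ => ⟨0, by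
    rintro _ ⟨i, rfl⟩
    exact (gsTerm_zero ω l i).le⟩⟩
  add_mem' := by
    rintro f g ⟨hf, hf'⟩ ⟨hg, hg'⟩
    refine ⟨hf.add hg, fun l hl => ?_⟩
    obtain ⟨A, hA⟩ := hf' l hl
    obtain ⟨B, hB⟩ := hg' l hl
    refine ⟨A + B, ?_⟩
    rintro _ ⟨i, rfl⟩
    exact (gsTerm_add_le ω l hf hg i).trans (add_le_add (hA ⟨i, rfl⟩) (hB ⟨i, rfl⟩))
  smul_mem' := by
    rintro c f ⟨hf, hf'⟩
    refine ⟨hf.const_smul c, fun l hl => ?_⟩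
    obtain ⟨A, hA⟩ := hf' l hl
    refine ⟨‖c‖ * A, ?_⟩
    rintro _ ⟨i, rfl⟩
    rw [gsTerm_smul ω l c hf]
    exact mul_le_mul_of_nonneg_left (hA ⟨i, rfl⟩) (norm_nonneg c)

/-- The Gelfand-Shilov space `S_ω(ℝ)` of Beurling type. It is a type of its own so that it does not
inherit the topology of pointwise convergence. -/
def GelfandShilov (ω : ℝ → ℝ) : Type := ↥(gelfandShilovSubmodule ω)

namespace GelfandShilov

instance instAddCommGroup (ω : ℝ → ℝ) : AddCommGroup (GelfandShilov ω) :=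
  inferInstanceAs (AddCommGroup ↥(gelfandShilovSubmodule ω))

instance instModule (ω : ℝ → ℝ) : Module ℂ (GelfandShilov ω) :=
  inferInstanceAs (Module ℂ ↥(gelfandShilovSubmodule ω))

instance instFunLike (ω : ℝ → ℝ) : FunLike (GelfandShilov ω) ℝ ℂ where
  coe f := f.1
  coe_injective _ _ h := Subtype.ext h

theorem smooth {ω : ℝ → ℝ} (f : GelfandShilov ω) : ContDiff ℝ (⊤ : ℕ∞) (f : ℝ → ℂ) := f.2.1

theorem bdd {ω : ℝ → ℝ} (f : GelfandShilov ω) {l : ℝ} (hl : 0 < l) :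
    BddAbove (range (gsTerm ω l f)) := f.2.2 l hl

/-- The norms `p_{ω, l}(f) = sup_{x, n, q} (1 + |x|)^q |f^(n)(x)| exp(-l φ_ω^*((n + q) / l))`,
`l > 0`, of `S_ω(ℝ)`. -/
def seminormFamily (ω : ℝ → ℝ) : SeminormFamily ℂ (GelfandShilov ω) {l : ℝ // 0 < l} :=
  fun l => Seminorm.of (fun f => ⨆ i, gsTerm ω l f i)
    (fun f g => ciSup_le fun i => (gsTerm_add_le ω l f.smooth g.smooth i).trans
      (add_le_add (le_ciSup (f.bdd l.2) i) (le_ciSup (g.bdd l.2) i)))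
    (fun c f => by
      rw [Real.mul_iSup_of_nonneg (norm_nonneg c)]
      exact iSup_congr fun i => gsTerm_smul ω l c f.smooth i)

theorem gsTerm_le_seminorm {ω : ℝ → ℝ} (l : {l : ℝ // 0 < l}) (f : GelfandShilov ω)
    (i : ℝ × ℕ × ℕ) : gsTerm ω l f i ≤ seminormFamily ω l f :=
  le_ciSup (f.bdd l.2) i

theorem seminorm_le {ω : ℝ → ℝ} (l : {l : ℝ // 0 < l}) (f : GelfandShilov ω) {C : ℝ}
    (h : ∀ i, gsTerm ω l f i ≤ C) : seminormFamily ω l f ≤ C :=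
  ciSup_le h

instance instNonemptyIndex : Nonempty {l : ℝ // 0 < l} := ⟨⟨1, one_pos⟩⟩

/-- The locally convex topology of `S_ω(ℝ)`, generated by the norms `p_{ω, l}`, `l > 0`, together
with its canonical translation invariant uniform structure. -/
instance instUniformSpace (ω : ℝ → ℝ) : UniformSpace (GelfandShilov ω) :=
  (seminormFamily ω).addGroupFilterBasis.uniformSpace

theorem withSeminorms (ω : ℝ → ℝ) : WithSeminorms (seminormFamily ω) := ⟨rfl⟩

instance instIsTopologicalAddGroup (ω : ℝ → ℝ) : IsTopologicalAddGroup (GelfandShilov ω) :=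
  (withSeminorms ω).topologicalAddGroup

instance instContinuousSMul (ω : ℝ → ℝ) : ContinuousSMul ℂ (GelfandShilov ω) :=
  (withSeminorms ω).continuousSMul

instance instIsUniformAddGroup (ω : ℝ → ℝ) : IsUniformAddGroup (GelfandShilov ω) :=
  (seminormFamily ω).addGroupFilterBasis.isUniformAddGroup

instance instT2Space (ω : ℝ → ℝ) : T2Space (GelfandShilov ω) := by
  have : T1Space (GelfandShilov ω) := by
    refine (withSeminorms ω).T1_of_separating fun f hf => ?_
    by_contra! h
    apply hf
    refine DFunLike.ext _ _ fun x => ?_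
    have h1 := (gsTerm_le_seminorm ⟨1, one_pos⟩ f (x, 0, 0)).trans (h _).le
    simp only [gsTerm, pow_zero, one_mul, iteratedDeriv_zero] at h1
    exact norm_le_zero_iff.1 (nonpos_of_mul_nonpos_left h1 (Real.exp_pos _))
  infer_instance

theorem schwartz_bound {ω : ℝ → ℝ} (f : GelfandShilov ω) (k n : ℕ) (x : ℝ) :
    ‖x‖ ^ k * ‖iteratedDeriv n f x‖ ≤
      Real.exp (youngConj ω ((n + k : ℕ) : ℝ)) * seminormFamily ω ⟨1, one_pos⟩ f := by
  have h := gsTerm_le_seminorm ⟨1, one_pos⟩ f (x, n, k)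
  simp only [gsTerm, one_mul, div_one] at h
  rw [Real.exp_neg, ← div_eq_mul_inv, div_le_iff₀ (Real.exp_pos _), mul_comm _ (Real.exp _)] at h
  refine le_trans ?_ h
  rw [Real.norm_eq_abs]
  gcongr
  linarith

/-- The inclusion `S_ω(ℝ) → S(ℝ)` as a linear map. -/
def toSchwartzLM (ω : ℝ → ℝ) : GelfandShilov ω →ₗ[ℂ] 𝓢(ℝ, ℂ) where
  toFun f :=
    { toFun := f
      smooth' := f.smooth
      decay' := fun k n => ⟨_, fun x => by
        rw [norm_iteratedFDeriv_eq_norm_iteratedDeriv]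
        exact schwartz_bound f k n x⟩ }
  map_add' _ _ := rfl
  map_smul' _ _ := rfl

/-- The inclusion `S_ω(ℝ) → S(ℝ)` as a continuous linear map. -/
def toSchwartz (ω : ℝ → ℝ) : GelfandShilov ω →L[ℂ] 𝓢(ℝ, ℂ) where
  toLinearMap := toSchwartzLM ω
  cont := by
    refine WithSeminorms.continuous_of_isBounded (withSeminorms ω) (schwartz_withSeminorms ℂ ℝ ℂ)
      (toSchwartzLM ω) fun i => ?_
    refine ⟨{⟨1, one_pos⟩}, ⟨Real.exp (youngConj ω ((i.2 + i.1 : ℕ) : ℝ)),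
      (Real.exp_pos _).le⟩, fun f => ?_⟩
    rw [Finset.sup_singleton]
    exact SchwartzMap.seminorm_le_bound' ℂ i.1 i.2 _
      (mul_nonneg (Real.exp_pos _).le (apply_nonneg _ _)) fun x => schwartz_bound f i.1 i.2 x

theorem toSchwartz_apply (ω : ℝ → ℝ) (f : GelfandShilov ω) (x : ℝ) :
    toSchwartz ω f x = f x := rfl

theorem exists_weight_mul_le {ω : ℝ → ℝ} (hω : IsWeightFunction ω) {B : ℝ} (hB : 1 ≤ B) :
    ∃ K : ℝ, 1 ≤ K ∧ ∀ t, 0 ≤ t → ω (B * t) ≤ K * (ω t + 1) := by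
  obtain ⟨L, hL, h⟩ := hω.alpha
  have iter : ∀ N : ℕ, ∃ K : ℝ, 1 ≤ K ∧ ∀ t, 0 ≤ t → ω (2 ^ N * t) ≤ K * (ω t + 1) := by
    intro N
    induction N with
    | zero => exact ⟨1, le_rfl, fun t _ => by simp⟩
    | succ N ih =>
      obtain ⟨K, hK, hK'⟩ := ih
      refine ⟨L * (K + 1), by nlinarith, fun t ht => ?_⟩
      have h1 := h (2 ^ N * t) (by positivity)
      have h2 := hK' t ht
      have h3 := hω.nonneg t ht
      rw [pow_succ', mul_assoc]
      refine h1.trans ?_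
      rw [mul_assoc]
      exact mul_le_mul_of_nonneg_left (by nlinarith) (by linarith)
  obtain ⟨N, hN⟩ := pow_unbounded_of_one_lt B (one_lt_two)
  obtain ⟨K, hK, hK'⟩ := iter N
  refine ⟨K, hK, fun t ht => le_trans (hω.monotoneOn ?_ ?_ ?_) (hK' t ht)⟩
  · exact mem_Ici.2 (by positivity)
  · exact mem_Ici.2 (by positivity)
  · exact mul_le_mul_of_nonneg_right hN.le ht

theorem exists_pow_mul_exp_le {ω : ℝ → ℝ} (hω : IsWeightFunction ω) {B : ℝ} (hB : 1 ≤ B)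
    {l : ℝ} (hl : 0 < l) : ∃ m : ℝ, 0 < m ∧ ∀ n : ℕ,
      B ^ n * Real.exp (-(l * youngConj ω ((n : ℝ) / l))) ≤
        Real.exp m * Real.exp (-(m * youngConj ω ((n : ℝ) / m))) := by
  obtain ⟨K, hK, h⟩ := exists_weight_mul_le hω hB
  have hm : 0 < l * K := by positivity
  have hlogB := Real.log_nonneg hB
  have hB0 : 0 < B := by linarith
  refine ⟨l * K, hm, fun n => ?_⟩
  have hB' : B ^ n = Real.exp (n * Real.log B) := by
    rw [mul_comm, Real.exp_mul, Real.exp_log hB0, Real.rpow_natCast]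
  rw [hB', ← Real.exp_add, ← Real.exp_add, Real.exp_le_exp]
  have key : youngConj ω ((n : ℝ) / (l * K)) ≤
      (l * youngConj ω ((n : ℝ) / l) + l * K - n * Real.log B) / (l * K) := by
    refine csSup_le ((nonempty_Ici).image _) ?_
    rintro _ ⟨t, ht, rfl⟩
    have ht : 0 ≤ t := ht
    change (n : ℝ) / (l * K) * t - ω (Real.exp t) ≤ _
    have h1 : (n : ℝ) / l * (t + Real.log B) - ω (Real.exp (t + Real.log B)) ≤
        youngConj ω ((n : ℝ) / l) :=
      le_csSup (hω.bddAbove_youngConj _) ⟨t + Real.log B, by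
        exact mem_Ici.2 (by positivity), rfl⟩
    have h2 := h (Real.exp t) (Real.exp_pos t).le
    rw [Real.exp_add, Real.exp_log hB0, mul_comm (Real.exp t)] at h1
    have h3 : (n : ℝ) / l * (t + Real.log B) ≤
        youngConj ω ((n : ℝ) / l) + K * (ω (Real.exp t) + 1) := by linarith
    have h4 := mul_le_mul_of_nonneg_left h3 hl.le
    have h5 : l * ((n : ℝ) / l * (t + Real.log B)) = n * (t + Real.log B) := by
      field_simp
    rw [h5] at h4
    rw [le_div_iff₀ hm, sub_mul]
    have h6 : (n : ℝ) / (l * K) * t * (l * K) = n * t := by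
      field_simp
    rw [h6]
    nlinarith
  rw [le_div_iff₀ hm] at key
  linarith

theorem gsTerm_dilation_le {ω : ℝ → ℝ} (hω : IsWeightFunction ω) {a : ℝ} (ha : a ≠ 0)
    {l : ℝ} (hl : 0 < l) : ∃ m : ℝ, 0 < m ∧ ∀ f : ℝ → ℂ, ContDiff ℝ (⊤ : ℕ∞) f → ∀ i : ℝ × ℕ × ℕ,
      gsTerm ω l (fun x => f (a * x)) i ≤
        Real.exp m * gsTerm ω m f (a * i.1, i.2) := by
  set B : ℝ := |a| + |a|⁻¹ + 1
  have ha' : 0 < |a| := abs_pos.2 ha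
  have ha'' : 0 < |a|⁻¹ := inv_pos.2 ha'
  have hB : 1 ≤ B := by simp only [B]; linarith
  obtain ⟨m, hm, h⟩ := exists_pow_mul_exp_le hω hB hl
  refine ⟨m, hm, fun f hf i => ?_⟩
  obtain ⟨x, n, q⟩ := i
  simp only [gsTerm]
  have hf' : ContDiff ℝ n f := hf.of_le (by exact_mod_cast le_top)
  have hn : iteratedDeriv n (fun x => f (a * x)) x = a ^ n • iteratedDeriv n f (a * x) :=
    congrFun (iteratedDeriv_comp_const_smul hf' a) x
  rw [hn, norm_smul, norm_pow, Real.norm_eq_abs]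
  have h1 : (1 + |x|) ^ q ≤ B ^ q * (1 + |a * x|) ^ q := by
    rw [← mul_pow]
    gcongr
    rw [abs_mul]
    have : |a|⁻¹ * (|a| * |x|) = |x| := by field_simp
    have h0 : 0 ≤ |a| * |x| := by positivity
    have h00 : 0 ≤ |a| * (|a| * |x|) := by positivity
    simp only [B]
    nlinarith
  have h2 : |a| ^ n ≤ B ^ n := by
    gcongr
    simp only [B]
    linarith
  have h3 := h (n + q)
  calc (1 + |x|) ^ q * (|a| ^ n * ‖iteratedDeriv n f (a * x)‖) *
        Real.exp (-(l * youngConj ω (((n + q : ℕ) : ℝ) / l)))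
      ≤ (B ^ q * (1 + |a * x|) ^ q) * (B ^ n * ‖iteratedDeriv n f (a * x)‖) *
        Real.exp (-(l * youngConj ω (((n + q : ℕ) : ℝ) / l))) := by gcongr
    _ = ((1 + |a * x|) ^ q * ‖iteratedDeriv n f (a * x)‖) *
        (B ^ (n + q) * Real.exp (-(l * youngConj ω (((n + q : ℕ) : ℝ) / l)))) := by
        rw [pow_add]; ring
    _ ≤ ((1 + |a * x|) ^ q * ‖iteratedDeriv n f (a * x)‖) *
        (Real.exp m * Real.exp (-(m * youngConj ω (((n + q : ℕ) : ℝ) / m)))) := by gcongr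
    _ = _ := by ring

/-- The composition operator `C_ψ : S_ω(ℝ) → S_ω(ℝ)`, `f ↦ f ∘ ψ`, for `ψ(x) = a x`, `a ≠ 0`,
as a linear map. -/
def compDilationLM {ω : ℝ → ℝ} (hω : IsWeightFunction ω) {a : ℝ} (ha : a ≠ 0) :
    GelfandShilov ω →ₗ[ℂ] GelfandShilov ω where
  toFun f := ⟨fun x => f (a * x), by
    refine ⟨f.smooth.comp (contDiff_const.mul contDiff_id), fun l hl => ?_⟩
    obtain ⟨m, hm, h⟩ := gsTerm_dilation_le hω ha hl
    refine ⟨Real.exp m * seminormFamily ω ⟨m, hm⟩ f, ?_⟩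
    rintro _ ⟨i, rfl⟩
    exact (h f f.smooth i).trans
      (mul_le_mul_of_nonneg_left (gsTerm_le_seminorm ⟨m, hm⟩ f _) (Real.exp_pos m).le)⟩
  map_add' _ _ := rfl
  map_smul' _ _ := rfl

/-- The composition operator `C_ψ : S_ω(ℝ) → S_ω(ℝ)`, `f ↦ f ∘ ψ`, for `ψ(x) = a x`, `a ≠ 0`,
as a continuous linear operator. -/
def compDilation {ω : ℝ → ℝ} (hω : IsWeightFunction ω) {a : ℝ} (ha : a ≠ 0) :
    GelfandShilov ω →L[ℂ] GelfandShilov ω where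
  toLinearMap := compDilationLM hω ha
  cont := by
    refine WithSeminorms.continuous_of_isBounded (withSeminorms ω) (withSeminorms ω)
      (compDilationLM hω ha) fun l => ?_
    obtain ⟨m, hm, h⟩ := gsTerm_dilation_le hω ha l.2
    refine ⟨{⟨m, hm⟩}, ⟨Real.exp m, (Real.exp_pos m).le⟩, fun f => ?_⟩
    rw [Finset.sup_singleton]
    exact seminorm_le l _ fun i => (h f f.smooth i).trans
      (mul_le_mul_of_nonneg_left (gsTerm_le_seminorm ⟨m, hm⟩ f _) (Real.exp_pos m).le)

theorem compDilation_apply {ω : ℝ → ℝ} (hω : IsWeightFunction ω) {a : ℝ} (ha : a ≠ 0)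
    (f : GelfandShilov ω) (x : ℝ) : compDilation hω ha f x = f (a * x) := rfl

/-- The iterates of `C_ψ` are the composition operators `C_{ψ_m}` of the iterates of `ψ`. -/
theorem compDilation_pow_apply {ω : ℝ → ℝ} (hω : IsWeightFunction ω) {a : ℝ} (ha : a ≠ 0)
    (m : ℕ) (f : GelfandShilov ω) (x : ℝ) :
    (compDilation hω ha ^ m) f x = f ((fun y => a * y)^[m] x) := by
  induction m generalizing f with
  | zero => rfl
  | succ m ih =>
    rw [pow_succ, mul_apply_eq_comp, ih, compDilation_apply,
      Function.iterate_succ_apply']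

/-- The operator `C_{ψ_m} : S_ω(ℝ) → S(ℝ)`, `f ↦ f ∘ ψ_m`, where `ψ_m` is the `m`-th iterate of
`ψ(x) = a x`, `a ≠ 0`. -/
def compIterateSchwartz {ω : ℝ → ℝ} (hω : IsWeightFunction ω) {a : ℝ} (ha : a ≠ 0) (m : ℕ) :
    GelfandShilov ω →L[ℂ] 𝓢(ℝ, ℂ) :=
  (toSchwartz ω).comp (compDilation hω ha ^ m)

theorem compIterateSchwartz_apply {ω : ℝ → ℝ} (hω : IsWeightFunction ω) {a : ℝ} (ha : a ≠ 0)
    (m : ℕ) (f : GelfandShilov ω) (x : ℝ) :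
    compIterateSchwartz hω ha m f x = f ((fun y => a * y)^[m] x) :=
  compDilation_pow_apply hω ha m f x

end GelfandShilov

/-- A continuous linear operator is power bounded if its iterates `T^k`, `k ≥ 1`, are
equicontinuous. -/
def IsPowerBounded {E : Type*} [AddCommGroup E] [Module ℂ E] [UniformSpace E]
    (T : E →L[ℂ] E) : Prop :=
  Equicontinuous fun (k : ℕ+) (x : E) => (T ^ (k : ℕ)) x

/-- `T` is topologizable: for every continuous seminorm `p` there is a continuous seminorm `q` such
that for every `k ≥ 1` there is `M > 0` with `p (T^k x) ≤ M q(x)` for all `x`. -/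
def IsTopologizable {E : Type*} [AddCommGroup E] [Module ℂ E] [TopologicalSpace E]
    (T : E →L[ℂ] E) : Prop :=
  ∀ p : Seminorm ℂ E, Continuous p → ∃ q : Seminorm ℂ E, Continuous q ∧
    ∀ k : ℕ+, ∃ M : ℝ, 0 < M ∧ ∀ x, p ((T ^ (k : ℕ)) x) ≤ M * q x

/-- `T` is m-topologizable: for every continuous seminorm `p` there are a continuous seminorm `q`
and `C ≥ 1` with `p (T^k x) ≤ C^k q(x)` for all `k ≥ 1` and all `x`. -/
def IsMTopologizable {E : Type*} [AddCommGroup E] [Module ℂ E] [TopologicalSpace E]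
    (T : E →L[ℂ] E) : Prop :=
  ∀ p : Seminorm ℂ E, Continuous p → ∃ q : Seminorm ℂ E, Continuous q ∧
    ∃ C : ℝ, 1 ≤ C ∧ ∀ (k : ℕ+) (x : E), p ((T ^ (k : ℕ)) x) ≤ C ^ (k : ℕ) * q x

end

/-! If `|a| = 1`, then `ψ ∘ ψ` is the identity and the powers of `C_ψ` form a set of at most two
continuous operators, so 5 gives 1 and 2. Continuity of the inclusion into the Schwartz space gives
1 ⇒ 4, and 2 ⇒ 3 is formal. The content is that 3 and 4 each force `|a| = 1`.

The test functions are time-frequency shifts `exp(iσx) exp(-(x-τ)²/2)`. Every continuous seminorm is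
at most `D exp(K ω(2(1+σ+τ)))` on them, with `D`, `K` independent of the shift
(`exists_seminorm_gaborGS_le`). If `|a| > 1`, the `n`-th derivative at 0 of the `k`-th iterate of a
modulation by `s` is at least `(|a|^k s)^n` in modulus. If `|a| < 1`, a translate by `s` is moved to
`a^{-k} s`, and the polynomial weight of order `n` there exceeds `(|a|^{-k} s)^n`. With `A =
max(|a|, |a|⁻¹)`, topologizability bounds `(A^k s)^n exp(-φ^*(n))` by `M_k exp(K ω(4s))`. Optimizing
over `n` by biconjugation gives, up to a logarithm and a constant, `ω(A^k s) ≤ K ω(4s)`, with `K`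
independent of `k`. Iterating (ζ) makes the left side exceed any multiple of `ω(4s)` once `k` is
large, a contradiction (`not_exists_pow_bound`).

For 4, fixed test functions and the seminorms `sup |f'|` and `sup |x f|` already suffice; (ζ) enters
only in 3 ⇒ 5. -/

/-! ### Weight functions and their Young conjugates -/

theorem IsWeightFunction.le_youngConj {ω : ℝ → ℝ} (hω : IsWeightFunction ω) (s : ℝ) {t : ℝ}
    (ht : 0 ≤ t) : s * t - ω (Real.exp t) ≤ youngConj ω s :=
  le_csSup (hω.bddAbove_youngConj s) ⟨t, ht, rfl⟩

/-- The Fenchel inequality `r ^ N ≤ exp (l φ^*(N / l) + l ω(r))` for `r ≥ 1`. -/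
theorem IsWeightFunction.pow_le_exp {ω : ℝ → ℝ} (hω : IsWeightFunction ω) {l : ℝ} (hl : 0 < l)
    (N : ℕ) {r : ℝ} (hr : 1 ≤ r) :
    r ^ N ≤ Real.exp (l * ω r) * Real.exp (l * youngConj ω ((N : ℝ) / l)) := by
  have hr0 : 0 < r := by linarith
  have h := hω.le_youngConj ((N : ℝ) / l) (Real.log_nonneg hr)
  rw [Real.exp_log hr0] at h
  have h2 := mul_le_mul_of_nonneg_left h hl.le
  have h3 : l * ((N : ℝ) / l * Real.log r - ω r) = N * Real.log r - l * ω r := by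
    field_simp
  rw [← Real.exp_add, ← Real.rpow_natCast, Real.rpow_def_of_pos hr0, Real.exp_le_exp]
  linarith

/-- A weight function grows at most linearly. -/
theorem IsWeightFunction.exists_le_mul_add_one {ω : ℝ → ℝ} (hω : IsWeightFunction ω) :
    ∃ C : ℝ, 0 ≤ C ∧ ∀ t, 0 ≤ t → ω t ≤ C * (t + 1) := by
  set I : ℝ := ∫ t in Ioi 0, ω t / (1 + t ^ 2)
  have hnn : ∀ t ∈ Ioi (0 : ℝ), 0 ≤ ω t / (1 + t ^ 2) := fun t ht =>
    div_nonneg (hω.nonneg t (le_of_lt ht)) (by positivity)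
  have hI : 0 ≤ I := setIntegral_nonneg measurableSet_Ioi hnn
  -- On `(u, 2u]` with `u = t + 1 ≥ 1`, `ω ≥ ω(u)` and `1 + x² ≤ 5u²`. The interval has length `u`,
  -- so it contributes at least `ω(u) / (5u)` to the integral in (β).
  refine ⟨5 * I, by positivity, fun t ht => ?_⟩
  have hmono : ω t ≤ ω (t + 1) := hω.monotoneOn ht (mem_Ici.2 (by linarith)) (by linarith)
  refine hmono.trans ?_
  set u := t + 1
  have hu : 1 ≤ u := by simp only [u]; linarith
  have hsub : Ioc u (2 * u) ⊆ Ioi 0 := fun x hx => mem_Ioi.2 (by linarith [hx.1])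
  have h1 : ∫ x in Ioc u (2 * u), ω x / (1 + x ^ 2) ≤ I :=
    setIntegral_mono_set hω.beta ((ae_restrict_iff' measurableSet_Ioi).2 (ae_of_all _ hnn))
      (ae_of_all _ hsub)
  have h2 : ∫ _x in Ioc u (2 * u), ω u / (5 * u ^ 2) ≤ ∫ x in Ioc u (2 * u), ω x / (1 + x ^ 2) := by
    refine setIntegral_mono_on (by simp) (hω.beta.mono_set hsub) measurableSet_Ioc fun x hx => ?_
    have hx1 : ω u ≤ ω x :=
      hω.monotoneOn (mem_Ici.2 (by linarith)) (mem_Ici.2 (by linarith [hx.1])) hx.1.le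
    exact div_le_div₀ (hω.nonneg x (by linarith [hx.1])) hx1 (by positivity)
      (by nlinarith [hx.1, hx.2])
  rw [setIntegral_const, Real.volume_real_Ioc_of_le (by linarith), smul_eq_mul] at h2
  have h3 : (2 * u - u) * (ω u / (5 * u ^ 2)) = ω u / (5 * u) := by field_simp; ring
  rw [h3] at h2
  have h4 := h2.trans h1
  rw [div_le_iff₀ (by positivity)] at h4
  linarith

/-- Fenchel's inequality at `r = N + 1`: since `ω` grows at most linearly, `exp(l ω(N+1))` is only
geometric in `N`, and `R` absorbs it. This is what admits functions with factorial bounds, such as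
the Gaussian, into `S_ω`. -/
theorem IsWeightFunction.exists_pow_self_le {ω : ℝ → ℝ} (hω : IsWeightFunction ω) {l : ℝ}
    (hl : 0 < l) : ∃ R D : ℝ, 0 < R ∧ 0 ≤ D ∧ ∀ N : ℕ,
      ((N : ℝ) / R) ^ N ≤ D * Real.exp (l * youngConj ω ((N : ℝ) / l)) := by
  obtain ⟨C, hC, h⟩ := hω.exists_le_mul_add_one
  refine ⟨Real.exp (l * C), Real.exp (2 * l * C), Real.exp_pos _, (Real.exp_pos _).le,
    fun N => ?_⟩
  have h1 := hω.pow_le_exp hl N (r := N + 1) (by linarith [Nat.cast_nonneg (α := ℝ) N])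
  have h2 : l * ω (N + 1) ≤ 2 * l * C + N * (l * C) := by
    have := mul_le_mul_of_nonneg_left (h (N + 1) (by positivity)) hl.le
    linarith
  rw [div_pow, div_le_iff₀ (by positivity), ← Real.exp_nat_mul]
  calc (N : ℝ) ^ N ≤ (N + 1 : ℝ) ^ N := by gcongr; linarith
    _ ≤ _ := h1
    _ ≤ Real.exp (2 * l * C + N * (l * C)) * Real.exp (l * youngConj ω ((N : ℝ) / l)) := by
      gcongr
    _ = _ := by rw [Real.exp_add]; ring

/-- The biconjugate inequality, with integer exponents. -/
theorem IsWeightFunction.exists_exp_le_pow {ω : ℝ → ℝ} (hω : IsWeightFunction ω) {r : ℝ}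
    (hr : 1 ≤ r) : ∃ n : ℕ,
      Real.exp (ω r) ≤ Real.exp 1 * r * (r ^ n * Real.exp (-youngConj ω n)) := by
  have hr0 : 0 < r := by linarith
  have hcont : Continuous fun t : ℝ => ω (Real.exp t) :=
    hω.continuousOn.comp_continuous Real.continuous_exp fun t => (Real.exp_pos t).le
  set u := Real.log r
  have hu : 0 ≤ u := Real.log_nonneg hr
  have hexp : Real.exp u = r := Real.exp_log hr0
  -- An affine minorant `ct + d` of the convex function `φ_ω` that misses it at `u` by at most 1.
  -- Rounding the slope down to `n = ⌊c⌋` costs at most the factor `r`; the gap 1 costs the factor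
  -- `e`.
  obtain ⟨c, d, hle, heq⟩ := hω.delta.exists_affine_le_of_lt_real (mem_univ u)
    (sub_one_lt (ω (Real.exp u))) isClosed_univ (hcont.lowerSemicontinuous.lowerSemicontinuousOn _)
  have hc : 0 ≤ c := by
    by_contra! hneg
    -- With negative slope, the minorant would gain 2 on moving left by `2/|c|`, more than the gap
    -- 1, while `φ_ω` does not increase to the left.
    have h1 := hle (u + 2 / c) (mem_univ _)
    have h2 : ω (Real.exp (u + 2 / c)) ≤ ω (Real.exp u) :=
      hω.monotoneOn (Real.exp_pos _).le (Real.exp_pos _).le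
        (Real.exp_le_exp.2 (by linarith [div_neg_of_pos_of_neg two_pos hneg]))
    have h3 : c * (u + 2 / c) = c * u + 2 := by have := hneg.ne; field_simp
    beta_reduce at h1
    linarith
  refine ⟨⌊c⌋₊, ?_⟩
  have hn1 : (⌊c⌋₊ : ℝ) ≤ c := Nat.floor_le hc
  have hn2 : c < ⌊c⌋₊ + 1 := Nat.lt_floor_add_one c
  have hY : youngConj ω (⌊c⌋₊ : ℝ) ≤ -d := by
    refine csSup_le (nonempty_Ici.image _) ?_
    rintro _ ⟨t, ht, rfl⟩
    have ht : 0 ≤ t := ht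
    have h1 := hle t (mem_univ t)
    beta_reduce at h1 ⊢
    nlinarith
  nth_rewrite 2 3 [← hexp]
  rw [← Real.exp_nat_mul, ← Real.exp_add, ← Real.exp_add, ← Real.exp_add, Real.exp_le_exp]
  rw [hexp] at heq
  nlinarith

/-- Iteration of (ζ). The base `H` does not depend on `j`, so any factor in front of `ω` is beaten
by a suitable dilation. -/
theorem ConditionZeta.exists_pow_le {ω : ℝ → ℝ} (hζ : ConditionZeta ω) :
    ∃ H : ℝ, 1 ≤ H ∧ ∀ j : ℕ, ∃ C : ℝ, ∀ t, 0 ≤ t → 2 ^ j * ω t ≤ ω (H ^ j * t) + C := by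
  obtain ⟨H, hH, h⟩ := hζ
  refine ⟨H, hH, fun j => ?_⟩
  induction j with
  | zero => exact ⟨0, fun t _ => by simp⟩
  | succ j ih =>
    obtain ⟨C, hC⟩ := ih
    refine ⟨H + 2 * C, fun t ht => ?_⟩
    have h1 := h (H ^ j * t) (by positivity)
    have h2 := hC t ht
    rw [← mul_assoc, ← pow_succ'] at h1
    rw [pow_succ']
    linarith

/-- A weight function dominates the logarithm. -/
theorem IsWeightFunction.exists_log_le {ω : ℝ → ℝ} (hω : IsWeightFunction ω) :
    ∃ C : ℝ, ∀ r, 1 ≤ r → 2 * Real.log r ≤ ω r + C := by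
  refine ⟨youngConj ω 2, fun r hr => ?_⟩
  have := hω.le_youngConj 2 (Real.log_nonneg hr)
  rw [Real.exp_log (by linarith)] at this
  linarith

/-- Under condition (ζ), large dilations of `ω` are not bounded by a fixed multiple of `ω`. -/
theorem IsWeightFunction.not_exists_pow_bound {ω : ℝ → ℝ} (hω : IsWeightFunction ω)
    (hζ : ConditionZeta ω) {A K : ℝ} (hA : 1 < A)
    (h : ∀ k : ℕ+, ∃ M : ℝ, ∀ s : ℝ, 1 ≤ s → ∀ n : ℕ,
      (A ^ (k : ℕ) * s) ^ n * Real.exp (-youngConj ω n) ≤ M * Real.exp (K * ω (4 * s))) :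
    False := by
  obtain ⟨H, hH, hHj⟩ := hζ.exists_pow_le
  -- Absorbing the logarithm into half of `ω(A^k s)` doubles `K`; the surplus 1 leaves a full
  -- `ω(4s)` on the left. The choice `A^k > 4 H^j` below makes `A^k s` dominate `H^j (4s)`.
  obtain ⟨j, hj⟩ := pow_unbounded_of_one_lt (2 * K + 1) (one_lt_two)
  obtain ⟨C, hC⟩ := hHj j
  obtain ⟨k, hk⟩ := pow_unbounded_of_one_lt (4 * H ^ j) hA
  have hk0 : 0 < k := by
    rcases Nat.eq_zero_or_pos k with rfl | h0
    · have : 1 ≤ H ^ j := one_le_pow₀ hH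
      rw [pow_zero] at hk
      linarith
    · exact h0
  obtain ⟨M, hM⟩ := h ⟨k, hk0⟩
  rw [PNat.mk_coe] at hM
  obtain ⟨E, hE⟩ := hω.exists_log_le
  have hAk : 1 ≤ A ^ k := one_le_pow₀ hA.le
  -- `M` need not be positive, and its logarithm is taken below.
  set M' : ℝ := max M 1
  have hbound : ∀ s : ℝ, 1 ≤ s → ω (4 * s) ≤ 2 + E + 2 * Real.log M' + C := by
    intro s hs
    have hr : 1 ≤ A ^ k * s := by nlinarith
    have hr0 : 0 < A ^ k * s := by linarith
    have hM'0 : 0 < M' := lt_of_lt_of_le one_pos (le_max_right _ _)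
    obtain ⟨n, hn⟩ := hω.exists_exp_le_pow hr
    have h1 : Real.exp (ω (A ^ k * s)) ≤
        Real.exp (1 + Real.log (A ^ k * s) + (Real.log M' + K * ω (4 * s))) := by
      rw [Real.exp_add, Real.exp_add, Real.exp_add, Real.exp_log hr0, Real.exp_log hM'0]
      refine hn.trans (mul_le_mul_of_nonneg_left ((hM s hs n).trans ?_) (by positivity))
      gcongr
      exact le_max_left _ _
    rw [Real.exp_le_exp] at h1
    have h2 := hE _ hr
    have h3 := hC (4 * s) (by positivity)
    have h4 : ω (H ^ j * (4 * s)) ≤ ω (A ^ k * s) :=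
      hω.monotoneOn (mem_Ici.2 (by positivity)) (mem_Ici.2 hr0.le) (by nlinarith)
    have h5 := hω.nonneg (4 * s) (by positivity)
    nlinarith
  have htend : Tendsto (fun s : ℝ => Real.log (4 * s)) atTop atTop :=
    Real.tendsto_log_atTop.comp (tendsto_id.const_mul_atTop (by norm_num))
  obtain ⟨s, hs, hs1⟩ := ((htend.eventually_gt_atTop
    ((2 + E + 2 * Real.log M' + C + E) / 2)).and (eventually_ge_atTop 1)).exists
  have h1 := hbound s hs1
  have h2 := hE (4 * s) (by linarith)
  linarith

/-! ### Derivatives of the Gaussian -/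

theorem iteratedDeriv_comp_ofReal {F : ℂ → ℂ} (hF : Differentiable ℂ F) (n : ℕ) :
    iteratedDeriv n (fun x : ℝ => F x) = fun x : ℝ => iteratedDeriv n F x := by
  induction n with
  | zero => simp
  | succ n ih =>
    rw [iteratedDeriv_succ, ih, iteratedDeriv_succ]
    funext x
    have hd : Differentiable ℂ (iteratedDeriv n F) :=
      (hF.contDiff (n := (n + 1 : ℕ))).differentiable_iteratedDeriv' n
    exact (hd x).hasDerivAt.comp_ofReal.deriv

namespace GelfandShilov

/-- The Gaussian `x ↦ exp(-x²/2)`, as a complex valued function. -/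
noncomputable def gaussian (x : ℝ) : ℂ := Complex.exp (-((x : ℂ) ^ 2 / 2))

theorem differentiable_cexp_neg_sq : Differentiable ℂ fun z : ℂ => Complex.exp (-(z ^ 2 / 2)) := by
  fun_prop

theorem contDiff_gaussian : ContDiff ℝ (⊤ : ℕ∞) gaussian := by
  unfold gaussian
  have : ContDiff ℝ (⊤ : ℕ∞) fun x : ℝ => (x : ℂ) := Complex.ofRealCLM.contDiff
  fun_prop

/-- The derivatives of the Gaussian decay faster than `exp(-R|x|)` and grow slower than
`n! R^{-n}`, for every `R`. -/
theorem exists_norm_iteratedDeriv_gaussian_le {R : ℝ} (hR : 0 < R) :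
    ∃ C : ℝ, 0 ≤ C ∧ ∀ (n : ℕ) (x : ℝ),
      ‖iteratedDeriv n gaussian x‖ ≤ C * Real.exp (-(R * |x|)) * n.factorial / R ^ n := by
  refine ⟨Real.exp (3 * R ^ 2), (Real.exp_pos _).le, fun n x => ?_⟩
  -- Cauchy's estimate on the circle of radius `R` about `x`, where `(Im² z - Re² z)/2 ≤ 3R² -
  -- R|x|`.
  have h := Complex.norm_iteratedDeriv_le_of_forall_mem_sphere_norm_le (c := (x : ℂ)) (R := R)
    (C := Real.exp (3 * R ^ 2) * Real.exp (-(R * |x|))) n hR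
    differentiable_cexp_neg_sq.diffContOnCl (fun z hz => by
      rw [mem_sphere_iff_norm] at hz
      rw [Complex.norm_exp, ← Real.exp_add, Real.exp_le_exp]
      have h1 : (z.re - x) ^ 2 + z.im ^ 2 = R ^ 2 := by
        have := Complex.sq_norm (z - x)
        rw [hz, Complex.normSq_apply] at this
        simp at this
        linarith
      have h2 : (-(z ^ 2 / 2)).re = -((z.re ^ 2 - z.im ^ 2) / 2) := by
        rw [sq z]; simp; ring
      rw [h2]
      have h3 : |x| ≤ |z.re| + R := by
        have h4 : |z.re - x| ≤ R := abs_le_of_sq_le_sq (by nlinarith) hR.le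
        have := abs_sub_abs_le_abs_sub x z.re
        rw [abs_sub_comm] at this
        linarith
      nlinarith [sq_nonneg (|z.re| - R), sq_abs z.re, sq_nonneg (z.re - x)])
  unfold gaussian
  rw [iteratedDeriv_comp_ofReal differentiable_cexp_neg_sq]
  refine h.trans_eq ?_
  ring

/-- The exponential series bounds the polynomial weight by `exp(R(1+|x|)) q!/R^q`, which the factor
`exp(-R|x|)` of the Gaussian pays for; then `n! q! ≤ (n+q)^(n+q)`. -/
theorem exists_pow_mul_norm_iteratedDeriv_gaussian_le {R : ℝ} (hR : 0 < R) :
    ∃ C : ℝ, 0 ≤ C ∧ ∀ (n q : ℕ) (x : ℝ),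
      (1 + |x|) ^ q * ‖iteratedDeriv n gaussian x‖ ≤ C * (((n + q : ℕ) : ℝ) / R) ^ (n + q) := by
  obtain ⟨C, hC, h⟩ := exists_norm_iteratedDeriv_gaussian_le hR
  refine ⟨C * Real.exp R, by positivity, fun n q x => ?_⟩
  have h1 : (1 + |x|) ^ q ≤ Real.exp (R * (1 + |x|)) * q.factorial / R ^ q := by
    have := Real.pow_div_factorial_le_exp (R * (1 + |x|)) (by positivity) q
    rw [div_le_iff₀ (by positivity), mul_pow] at this
    rw [le_div_iff₀ (by positivity)]
    linarith
  have h2 : ((n.factorial : ℝ) * q.factorial) ≤ ((n + q : ℕ) : ℝ) ^ (n + q) := by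
    have := (Nat.le_of_dvd (Nat.factorial_pos _)
      (Nat.factorial_mul_factorial_dvd_factorial_add n q)).trans (Nat.factorial_le_pow (n + q))
    exact_mod_cast this
  calc (1 + |x|) ^ q * ‖iteratedDeriv n gaussian x‖
      ≤ (Real.exp (R * (1 + |x|)) * q.factorial / R ^ q) *
        (C * Real.exp (-(R * |x|)) * n.factorial / R ^ n) := by
        gcongr
        exact h n x
    _ = C * (Real.exp (R * (1 + |x|)) * Real.exp (-(R * |x|))) *
        ((n.factorial * q.factorial) / R ^ (n + q)) := by
        rw [pow_add]; field_simp
    _ = C * Real.exp R * ((n.factorial * q.factorial) / R ^ (n + q)) := by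
        rw [← Real.exp_add]; ring_nf
    _ ≤ _ := by
        rw [div_pow]
        gcongr

/-- Every derivative of the Gaussian at the origin is a nonnegative multiple of `I ^ k`. -/
theorem exists_iteratedDeriv_gaussian_zero (k : ℕ) :
    ∃ c : ℝ, 0 ≤ c ∧ iteratedDeriv k gaussian 0 = Complex.I ^ k * c := by
  have hreal : gaussian = fun x : ℝ => ((Real.exp (-(x ^ 2 / 2)) : ℝ) : ℂ) := by
    funext x; simp [gaussian]
  have hcont : ContDiff ℝ k fun x : ℝ => Real.exp (-(x ^ 2 / 2)) := by fun_prop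
  have h1 : iteratedDeriv k gaussian 0 =
      ((iteratedDeriv k (fun x : ℝ => Real.exp (-(x ^ 2 / 2))) 0 : ℝ) : ℂ) := by
    rw [hreal]
    have := ContinuousLinearMap.iteratedFDeriv_comp_left Complex.ofRealCLM
      (x := (0 : ℝ)) hcont.contDiffAt le_rfl
    exact congrArg (fun F => F fun _ => 1) this
  rw [h1, iteratedDeriv_eq_iterate, Polynomial.deriv_gaussian_eq_hermite_mul_gaussian]
  have h2 : Polynomial.aeval (0 : ℝ) (Polynomial.hermite k) =
      (((Polynomial.hermite k).coeff 0 : ℤ) : ℝ) := by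
    rw [Polynomial.coeff_zero_eq_aeval_zero]
    simp [Polynomial.aeval_def, Polynomial.eval₂_at_zero]
  rw [h2]
  -- For `k = 2m` the constant Hermite coefficient is `(-1)^m (2m-1)!!`, and `(-1)^m = I^k`; for odd
  -- `k` it vanishes.
  rcases Nat.even_or_odd k with hk | hk
  · obtain ⟨m, rfl⟩ := hk
    rw [← two_mul, show 2 * m = 2 * m + 0 from rfl, Polynomial.coeff_hermite_explicit]
    refine ⟨((2 * m - 1).doubleFactorial : ℝ), by positivity, ?_⟩
    simp [pow_mul]
  · rw [Polynomial.coeff_hermite_of_odd_add (by simpa using hk)]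
    exact ⟨0, le_rfl, by simp⟩

/-! ### Time-frequency shifts of the Gaussian -/

/-- The time-frequency shift `x ↦ exp(i σ x) exp(-(x - τ)² / 2)` of the Gaussian. -/
noncomputable def gabor (σ τ x : ℝ) : ℂ := Complex.exp (σ * Complex.I * x) * gaussian (x - τ)

theorem contDiff_cexp_mul_I (σ : ℝ) :
    ContDiff ℝ (⊤ : ℕ∞) fun x : ℝ => Complex.exp (σ * Complex.I * x) := by
  have : ContDiff ℝ (⊤ : ℕ∞) fun x : ℝ => (x : ℂ) := Complex.ofRealCLM.contDiff
  fun_prop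

theorem contDiff_gabor (σ τ : ℝ) : ContDiff ℝ (⊤ : ℕ∞) (gabor σ τ) :=
  (contDiff_cexp_mul_I σ).mul (contDiff_gaussian.comp (contDiff_id.sub contDiff_const))

theorem iteratedDeriv_cexp_mul_I (σ : ℝ) (n : ℕ) (x : ℝ) :
    iteratedDeriv n (fun x : ℝ => Complex.exp (σ * Complex.I * x)) x =
      (σ * Complex.I) ^ n * Complex.exp (σ * Complex.I * x) := by
  have := iteratedDeriv_comp_ofReal (F := fun z => Complex.exp (σ * Complex.I * z)) (by fun_prop) n
  rw [this, iteratedDeriv_cexp_const_mul]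

theorem iteratedDeriv_gabor (σ τ : ℝ) (n : ℕ) (x : ℝ) :
    iteratedDeriv n (gabor σ τ) x = ∑ k ∈ Finset.range (n + 1), (n.choose k : ℂ) *
      ((σ * Complex.I) ^ k * Complex.exp (σ * Complex.I * x)) *
        iteratedDeriv (n - k) gaussian (x - τ) := by
  have h1 : ContDiff ℝ n fun x : ℝ => gaussian (x - τ) :=
    (contDiff_gaussian.comp (contDiff_id.sub contDiff_const)).of_le (by exact_mod_cast le_top)
  have h2 : ContDiff ℝ n fun x : ℝ => Complex.exp (σ * Complex.I * x) :=
    (contDiff_cexp_mul_I σ).of_le (by exact_mod_cast le_top)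
  have h := iteratedDeriv_fun_mul (x := x) h2.contDiffAt h1.contDiffAt
  simp only [iteratedDeriv_cexp_mul_I, iteratedDeriv_comp_sub_const] at h
  exact h

theorem norm_iteratedDeriv_gabor_le {σ : ℝ} (hσ : 0 ≤ σ) (τ : ℝ) (n : ℕ) (x : ℝ) :
    ‖iteratedDeriv n (gabor σ τ) x‖ ≤ ∑ k ∈ Finset.range (n + 1),
      (n.choose k : ℝ) * σ ^ k * ‖iteratedDeriv (n - k) gaussian (x - τ)‖ := by
  rw [iteratedDeriv_gabor]
  refine (norm_sum_le _ _).trans_eq (Finset.sum_congr rfl fun k _ => ?_)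
  have : ‖Complex.exp (σ * Complex.I * x)‖ = 1 := by
    rw [Complex.norm_exp]; simp
  simp [this, abs_of_nonneg hσ]

theorem norm_gabor_self (τ : ℝ) : ‖gabor 0 τ τ‖ = 1 := by
  simp [gabor, gaussian]

/-- At the origin all terms of the Leibniz formula for `exp(i σ x) exp(-x² / 2)` have the same
argument. -/
theorem pow_le_norm_iteratedDeriv_gabor_zero {σ : ℝ} (hσ : 0 ≤ σ) (n : ℕ) :
    σ ^ n ≤ ‖iteratedDeriv n (gabor σ 0) 0‖ := by
  choose c hc hg using exists_iteratedDeriv_gaussian_zero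
  have h0 : c 0 = 1 := by
    have := hg 0
    simp [gaussian] at this
    exact_mod_cast this.symm
  have h : iteratedDeriv n (gabor σ 0) 0 = Complex.I ^ n *
      ((∑ k ∈ Finset.range (n + 1), n.choose k * σ ^ k * c (n - k) : ℝ) : ℂ) := by
    rw [iteratedDeriv_gabor, Complex.ofReal_sum, Finset.mul_sum]
    refine Finset.sum_congr rfl fun k hk => ?_
    have hk' : k + (n - k) = n := by have := Finset.mem_range.1 hk; omega
    rw [sub_zero, hg]
    conv_rhs => rw [← hk', pow_add, hk']
    simp only [mul_pow, Complex.ofReal_zero, mul_zero, Complex.exp_zero]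
    push_cast
    ring
  rw [h, norm_mul, norm_pow, Complex.norm_I, one_pow, one_mul]
  refine le_trans ?_ (Complex.norm_real _ ▸ Real.le_norm_self _)
  -- All terms are nonnegative; keep `k = n`, where `c 0 = 1`.
  have := Finset.single_le_sum (f := fun k => (n.choose k : ℝ) * σ ^ k * c (n - k))
    (fun k _ => mul_nonneg (by positivity) (hc _)) (Finset.self_mem_range_succ n)
  simpa [h0] using this

/-- One number `Q` dominates the three scales: frequency, position, and the Gaussian's own
`(n+q)/R`. Each term of the Leibniz and binomial expansions then carries exactly `n + q` factors
`Q`, and the binomial coefficients sum to `2^(n+q)`. -/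
theorem exists_pow_mul_norm_iteratedDeriv_gabor_le {R : ℝ} (hR : 0 < R) :
    ∃ C : ℝ, 0 ≤ C ∧ ∀ (σ τ Q : ℝ) (n q : ℕ), 0 ≤ σ → 0 ≤ τ → σ ≤ Q → 1 + τ ≤ Q →
      ((n + q : ℕ) : ℝ) / R ≤ Q → ∀ x : ℝ,
        (1 + |x|) ^ q * ‖iteratedDeriv n (gabor σ τ) x‖ ≤ C * (2 * Q) ^ (n + q) := by
  obtain ⟨C, hC, h⟩ := exists_pow_mul_norm_iteratedDeriv_gaussian_le hR
  refine ⟨C, hC, fun σ τ Q n q hσ hτ hσQ hτQ hQ x => ?_⟩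
  have hQ0 : 0 ≤ Q := by linarith
  set y := x - τ
  have hx : (1 + |x|) ^ q ≤ ∑ j ∈ Finset.range (q + 1),
      (1 + |y|) ^ j * (1 + τ) ^ (q - j) * (q.choose j : ℝ) := by
    rw [← add_pow]
    refine pow_le_pow_left₀ (by positivity) ?_ q
    have : |x| ≤ |y| + |τ| := by simpa [y] using abs_add_le (x - τ) τ
    rw [abs_of_nonneg hτ] at this
    linarith
  have hterm : ∀ j ∈ Finset.range (q + 1), ∀ k ∈ Finset.range (n + 1),
      ((1 + |y|) ^ j * (1 + τ) ^ (q - j) * (q.choose j : ℝ)) *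
        ((n.choose k : ℝ) * σ ^ k * ‖iteratedDeriv (n - k) gaussian y‖) ≤
      (q.choose j : ℝ) * ((n.choose k : ℝ) * (C * Q ^ (n + q))) := by
    intro j hj k hk
    have hj' : j ≤ q := by have := Finset.mem_range.1 hj; omega
    have hk' : k ≤ n := by have := Finset.mem_range.1 hk; omega
    have h1 : (1 + |y|) ^ j * ‖iteratedDeriv (n - k) gaussian y‖ ≤ C * Q ^ (n - k + j) := by
      refine (h (n - k) j y).trans ?_
      gcongr
      refine le_trans ?_ hQ
      gcongr
      omega
    calc ((1 + |y|) ^ j * (1 + τ) ^ (q - j) * (q.choose j : ℝ)) *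
          ((n.choose k : ℝ) * σ ^ k * ‖iteratedDeriv (n - k) gaussian y‖)
        = (q.choose j : ℝ) * ((n.choose k : ℝ) * ((1 + τ) ^ (q - j) * σ ^ k *
          ((1 + |y|) ^ j * ‖iteratedDeriv (n - k) gaussian y‖))) := by ring
      _ ≤ (q.choose j : ℝ) * ((n.choose k : ℝ) * (Q ^ (q - j) * Q ^ k *
          (C * Q ^ (n - k + j)))) := by gcongr
      _ = (q.choose j : ℝ) * ((n.choose k : ℝ) * (C * Q ^ (q - j + k + (n - k + j)))) := by
          rw [pow_add Q (q - j + k), pow_add Q (q - j)]; ring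
      _ = _ := by rw [show q - j + k + (n - k + j) = n + q by omega]
  calc (1 + |x|) ^ q * ‖iteratedDeriv n (gabor σ τ) x‖
      ≤ (∑ j ∈ Finset.range (q + 1), (1 + |y|) ^ j * (1 + τ) ^ (q - j) * (q.choose j : ℝ)) *
        ∑ k ∈ Finset.range (n + 1),
          (n.choose k : ℝ) * σ ^ k * ‖iteratedDeriv (n - k) gaussian y‖ := by
        gcongr
        exact norm_iteratedDeriv_gabor_le hσ τ n x
    _ ≤ ∑ j ∈ Finset.range (q + 1), ∑ k ∈ Finset.range (n + 1),
          (q.choose j : ℝ) * ((n.choose k : ℝ) * (C * Q ^ (n + q))) := by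
        rw [Finset.sum_mul_sum]
        exact Finset.sum_le_sum fun j hj => Finset.sum_le_sum fun k hk => hterm j hj k hk
    _ = (∑ j ∈ Finset.range (q + 1), (q.choose j : ℝ)) *
          (∑ k ∈ Finset.range (n + 1), (n.choose k : ℝ)) * (C * Q ^ (n + q)) := by
        simp only [← Finset.mul_sum, ← Finset.sum_mul, mul_assoc]
    _ = _ := by
        have h2 : ∀ m : ℕ, ∑ k ∈ Finset.range (m + 1), (m.choose k : ℝ) = 2 ^ m := fun m => by
          exact_mod_cast Nat.sum_range_choose m
        rw [h2, h2, mul_pow, pow_add 2]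
        ring

end GelfandShilov

/-! ### Seminorms of the time-frequency shifts in `S_ω` -/

namespace GelfandShilov

/-- If the shift is the largest scale, Fenchel's inequality at `2(1+σ+τ)` yields the factor `exp(l
ω)`; otherwise `(2Q)^N = (N/R)^N`, which `exists_pow_self_le` controls. -/
theorem exists_gsTerm_gabor_le {ω : ℝ → ℝ} (hω : IsWeightFunction ω) {l : ℝ} (hl : 0 < l) :
    ∃ D : ℝ, 0 ≤ D ∧ ∀ (σ τ : ℝ), 0 ≤ σ → 0 ≤ τ → ∀ i,
      gsTerm ω l (gabor σ τ) i ≤ D * Real.exp (l * ω (2 * (1 + σ + τ))) := by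
  obtain ⟨R, D, hR, hD, h⟩ := hω.exists_pow_self_le hl
  -- The radius `2R` cancels the 2 in `(2Q)^N`; the Gaussian allows any radius.
  obtain ⟨C, hC, hg⟩ := exists_pow_mul_norm_iteratedDeriv_gabor_le (R := 2 * R) (by positivity)
  refine ⟨C * (D + 1), by positivity, fun σ τ hσ hτ i => ?_⟩
  obtain ⟨x, n, q⟩ := i
  simp only [gsTerm]
  set Y := Real.exp (l * youngConj ω (((n + q : ℕ) : ℝ) / l))
  set W := Real.exp (l * ω (2 * (1 + σ + τ)))
  have hY : 0 < Y := Real.exp_pos _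
  have hW : 1 ≤ W := Real.one_le_exp (mul_nonneg hl.le (hω.nonneg _ (by positivity)))
  rw [Real.exp_neg, ← div_eq_mul_inv, div_le_iff₀ hY]
  set Q : ℝ := max (1 + σ + τ) (((n + q : ℕ) : ℝ) / (2 * R))
  have hQ : (2 * Q) ^ (n + q) ≤ (D + 1) * W * Y := by
    rcases max_choice (1 + σ + τ) (((n + q : ℕ) : ℝ) / (2 * R)) with hQ | hQ
    · have h1 := hω.pow_le_exp hl (n + q) (r := 2 * (1 + σ + τ)) (by linarith)
      simp only [Q, hQ]
      refine h1.trans ?_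
      rw [mul_assoc]
      exact le_mul_of_one_le_left (by positivity) (by linarith)
    · have h1 := h (n + q)
      simp only [Q, hQ]
      rw [show 2 * (((n + q : ℕ) : ℝ) / (2 * R)) = ((n + q : ℕ) : ℝ) / R by field_simp]
      refine h1.trans ?_
      gcongr
      nlinarith
  have h2 := hg σ τ Q n q hσ hτ (le_max_of_le_left (by linarith))
    (le_max_of_le_left (by linarith)) (le_max_right _ _) x
  refine h2.trans ((mul_le_mul_of_nonneg_left hQ hC).trans_eq ?_)
  ring

/-- The time-frequency shifts of the Gaussian as elements of `S_ω(ℝ)`. -/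
noncomputable def gaborGS {ω : ℝ → ℝ} (hω : IsWeightFunction ω) {σ τ : ℝ} (hσ : 0 ≤ σ)
    (hτ : 0 ≤ τ) : GelfandShilov ω :=
  ⟨gabor σ τ, contDiff_gabor σ τ, fun l hl => by
    obtain ⟨D, _, h⟩ := exists_gsTerm_gabor_le hω hl
    exact ⟨D * Real.exp (l * ω (2 * (1 + σ + τ))), by rintro _ ⟨i, rfl⟩; exact h σ τ hσ hτ i⟩⟩

theorem coe_gaborGS {ω : ℝ → ℝ} (hω : IsWeightFunction ω) {σ τ : ℝ} (hσ : 0 ≤ σ)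
    (hτ : 0 ≤ τ) : ⇑(gaborGS hω hσ hτ) = gabor σ τ := rfl

/-- A continuous seminorm on `S_ω(ℝ)` grows at most like `exp (K ω)` on time-frequency shifts of the
Gaussian. -/
theorem exists_seminorm_gaborGS_le {ω : ℝ → ℝ} (hω : IsWeightFunction ω)
    (p : Seminorm ℂ (GelfandShilov ω)) (hp : Continuous p) :
    ∃ D K : ℝ, 0 ≤ D ∧ 0 ≤ K ∧ ∀ (σ τ : ℝ) (hσ : 0 ≤ σ) (hτ : 0 ≤ τ),
      p (gaborGS hω hσ hτ) ≤ D * Real.exp (K * ω (2 * (1 + σ + τ))) := by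
  obtain ⟨s, C, -, hC⟩ := Seminorm.bound_of_continuous (withSeminorms ω) p hp
  have hs : ∃ D K : ℝ, 0 ≤ D ∧ 0 ≤ K ∧ ∀ (σ τ : ℝ) (hσ : 0 ≤ σ) (hτ : 0 ≤ τ),
      s.sup (seminormFamily ω) (gaborGS hω hσ hτ) ≤
        D * Real.exp (K * ω (2 * (1 + σ + τ))) := by
    classical
    clear hC
    induction s using Finset.induction_on with
    | empty => exact ⟨0, 0, le_rfl, le_rfl, fun σ τ hσ hτ => by simp⟩
    | insert l s _ ih =>
      obtain ⟨D, K, hD, hK, h⟩ := ih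
      obtain ⟨D', hD', h'⟩ := exists_gsTerm_gabor_le hω l.2
      refine ⟨max D D', max K l, le_max_of_le_left hD, le_max_of_le_left hK,
        fun σ τ hσ hτ => ?_⟩
      have hW := hω.nonneg (2 * (1 + σ + τ)) (by positivity)
      rw [Finset.sup_insert, Seminorm.sup_apply]
      have hl : seminormFamily ω l (gaborGS hω hσ hτ) ≤
          D' * Real.exp (l * ω (2 * (1 + σ + τ))) :=
        seminorm_le l (gaborGS hω hσ hτ) fun i => h' σ τ hσ hτ i
      refine max_le (hl.trans ?_) ((h σ τ hσ hτ).trans ?_)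
      · gcongr
        exacts [le_max_right _ _, le_max_right _ _]
      · gcongr
        exacts [le_max_left _ _, le_max_left _ _]
  obtain ⟨D, K, hD, hK, h⟩ := hs
  refine ⟨C * D, K, by positivity, hK, fun σ τ hσ hτ => (hC _).trans ?_⟩
  rw [smul_apply, NNReal.smul_def, smul_eq_mul, mul_assoc]
  exact mul_le_mul_of_nonneg_left (h σ τ hσ hτ) C.2

/-! ### Topologizability forces `|a| = 1` -/

theorem coe_compDilation_pow {ω : ℝ → ℝ} (hω : IsWeightFunction ω) {a : ℝ} (ha : a ≠ 0)
    (k : ℕ) (f : GelfandShilov ω) :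
    ⇑((compDilation hω ha ^ k) f) = fun x => f (a ^ k * x) := by
  funext x
  rw [compDilation_pow_apply, mul_left_iterate]

theorem iteratedDeriv_compDilation_pow {ω : ℝ → ℝ} (hω : IsWeightFunction ω) {a : ℝ}
    (ha : a ≠ 0) (k n : ℕ) (f : GelfandShilov ω) (x : ℝ) :
    iteratedDeriv n ((compDilation hω ha ^ k) f) x =
      (a ^ k) ^ n • iteratedDeriv n f (a ^ k * x) := by
  rw [coe_compDilation_pow]
  exact congrFun (iteratedDeriv_comp_const_smul
    (f.smooth.of_le (by exact_mod_cast le_top)) (a ^ k)) x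

/-- Modulations (`τ = 0`) are tested at the origin, where dilation multiplies the `n`-th derivative
by `a^{kn}`. The seminorm `q`, hence `K`, is fixed before `k`; only `M` depends on `k`. -/
theorem abs_le_one_of_isTopologizable {ω : ℝ → ℝ} (hω : IsWeightFunction ω)
    (hζ : ConditionZeta ω) {a : ℝ} (ha : a ≠ 0) (h : IsTopologizable (compDilation hω ha)) :
    |a| ≤ 1 := by
  by_contra! hA
  obtain ⟨q, hq, hk⟩ := h _ ((withSeminorms ω).continuous_seminorm ⟨1, one_pos⟩)
  obtain ⟨D, K, hD, hK, hqb⟩ := exists_seminorm_gaborGS_le hω q hq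
  refine hω.not_exists_pow_bound hζ hA (K := K) fun k => ?_
  obtain ⟨M, hM, hMq⟩ := hk k
  refine ⟨M * D, fun s hs n => ?_⟩
  have hs0 : 0 ≤ s := by linarith
  have h1 := (gsTerm_le_seminorm ⟨1, one_pos⟩ _ ((0 : ℝ), n, 0)).trans
    (hMq (gaborGS hω hs0 le_rfl))
  simp only [gsTerm, pow_zero, one_mul, add_zero, div_one] at h1
  rw [iteratedDeriv_compDilation_pow, mul_zero, coe_gaborGS, norm_smul, norm_pow, norm_pow,
    Real.norm_eq_abs] at h1
  calc (|a| ^ (k : ℕ) * s) ^ n * Real.exp (-youngConj ω n)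
      = (|a| ^ (k : ℕ)) ^ n * s ^ n * Real.exp (-youngConj ω n) := by rw [mul_pow]
    _ ≤ (|a| ^ (k : ℕ)) ^ n * ‖iteratedDeriv n (gabor s 0) 0‖ * Real.exp (-youngConj ω n) := by
      gcongr
      exact pow_le_norm_iteratedDeriv_gabor_zero hs0 n
    _ ≤ _ := h1
    _ ≤ M * (D * Real.exp (K * ω (2 * (1 + s + 0)))) := by
      gcongr
      exact hqb s 0 hs0 le_rfl
    _ ≤ M * (D * Real.exp (K * ω (4 * s))) := by
      gcongr
      exact hω.monotoneOn (mem_Ici.2 (by positivity)) (mem_Ici.2 (by positivity)) (by linarith)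
    _ = _ := by ring

/-- The dual test: translates (`σ = 0`) replace modulations and the weight `(1+|x|)^n` replaces
derivatives, evaluated at the displaced peak `a^{-k} s`. -/
theorem one_le_abs_of_isTopologizable {ω : ℝ → ℝ} (hω : IsWeightFunction ω)
    (hζ : ConditionZeta ω) {a : ℝ} (ha : a ≠ 0) (h : IsTopologizable (compDilation hω ha)) :
    1 ≤ |a| := by
  by_contra! hA
  have ha0 : 0 < |a| := abs_pos.2 ha
  obtain ⟨q, hq, hk⟩ := h _ ((withSeminorms ω).continuous_seminorm ⟨1, one_pos⟩)
  obtain ⟨D, K, hD, hK, hqb⟩ := exists_seminorm_gaborGS_le hω q hq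
  refine hω.not_exists_pow_bound hζ ((one_lt_inv₀ ha0).2 hA) (K := K) fun k => ?_
  obtain ⟨M, hM, hMq⟩ := hk k
  refine ⟨M * D, fun s hs n => ?_⟩
  have hs0 : 0 ≤ s := by linarith
  have hpow : a ^ (k : ℕ) ≠ 0 := pow_ne_zero _ ha
  have h1 := (gsTerm_le_seminorm ⟨1, one_pos⟩ _ ((a ^ (k : ℕ))⁻¹ * s, 0, n)).trans
    (hMq (gaborGS hω le_rfl hs0))
  simp only [gsTerm, one_mul, zero_add, div_one, iteratedDeriv_zero] at h1
  rw [coe_compDilation_pow] at h1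
  beta_reduce at h1
  rw [mul_inv_cancel_left₀ hpow, coe_gaborGS, norm_gabor_self, mul_one] at h1
  calc (|a|⁻¹ ^ (k : ℕ) * s) ^ n * Real.exp (-youngConj ω n)
      ≤ (1 + |(a ^ (k : ℕ))⁻¹ * s|) ^ n * Real.exp (-youngConj ω n) := by
        gcongr
        rw [abs_mul, abs_inv, abs_pow, inv_pow, abs_of_nonneg hs0]
        linarith
    _ ≤ _ := h1
    _ ≤ M * (D * Real.exp (K * ω (2 * (1 + 0 + s)))) := by
      gcongr
      exact hqb 0 s le_rfl hs0
    _ ≤ M * (D * Real.exp (K * ω (4 * s))) := by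
      gcongr
      exact hω.monotoneOn (mem_Ici.2 (by positivity)) (mem_Ici.2 (by positivity)) (by linarith)
    _ = _ := by ring

/-! ### Equicontinuity into the Schwartz space forces `|a| = 1` -/

theorem exists_schwartz_seminorm_le_of_equicontinuous {ω : ℝ → ℝ} (hω : IsWeightFunction ω)
    {a : ℝ} (ha : a ≠ 0)
    (h : Equicontinuous fun (m : ℕ+) (f : GelfandShilov ω) =>
      compIterateSchwartz hω ha (m : ℕ) f) (f : GelfandShilov ω) (j n : ℕ) :
    ∃ B : ℝ, ∀ (m : ℕ+) (x : ℝ),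
      |x| ^ j * ‖(a ^ (m : ℕ)) ^ n • iteratedDeriv n f (a ^ (m : ℕ) * x)‖ ≤ B := by
  have h1 := ((schwartz_withSeminorms ℂ ℝ ℂ).equicontinuous_TFAE
    (fun m : ℕ+ => (compIterateSchwartz hω ha (m : ℕ)).toLinearMap)).out 1 3
  obtain ⟨p, -, hp⟩ := h1.1 h (j, n)
  refine ⟨p f, fun m x => ?_⟩
  have h2 := SchwartzMap.le_seminorm' ℂ j n (compIterateSchwartz hω ha (m : ℕ) f) x
  have h3 : ⇑(compIterateSchwartz hω ha (m : ℕ) f) = ⇑((compDilation hω ha ^ (m : ℕ)) f) := rfl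
  rw [h3, iteratedDeriv_compDilation_pow] at h2
  exact h2.trans (hp m f)

/-- The first derivative at 0 of a modulated Gaussian keeps `|a|^m` bounded; the peak of a
translated one, at `a^{-m}` and weighted by `|x|`, keeps `|a|^{-m}` bounded. -/
theorem abs_eq_one_of_equicontinuous_compIterateSchwartz {ω : ℝ → ℝ} (hω : IsWeightFunction ω)
    {a : ℝ} (ha : a ≠ 0)
    (h : Equicontinuous fun (m : ℕ+) (f : GelfandShilov ω) =>
      compIterateSchwartz hω ha (m : ℕ) f) : |a| = 1 := by
  have ha0 : 0 < |a| := abs_pos.2 ha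
  have hbdd : ∀ b B : ℝ, (∀ m : ℕ+, b ^ (m : ℕ) ≤ B) → b ≤ 1 := by
    intro b B hb
    by_contra! hb1
    obtain ⟨m, hm⟩ := pow_unbounded_of_one_lt B hb1
    exact absurd (hb m.succPNat)
      (not_le.2 (hm.trans_le (pow_le_pow_right₀ hb1.le (Nat.le_succ m))))
  apply le_antisymm
  · have h1 := exists_schwartz_seminorm_le_of_equicontinuous hω ha h
      (gaborGS hω zero_le_one le_rfl) 0 1
    obtain ⟨B, hB⟩ := h1
    refine hbdd |a| B fun m => ?_
    have h2 := hB m 0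
    rw [pow_zero, one_mul, mul_zero, norm_smul, pow_one, norm_pow, Real.norm_eq_abs,
      coe_gaborGS] at h2
    refine le_trans ?_ h2
    have h3 := pow_le_norm_iteratedDeriv_gabor_zero zero_le_one 1
    rw [one_pow] at h3
    exact le_mul_of_one_le_right (by positivity) h3
  · obtain ⟨B, hB⟩ := exists_schwartz_seminorm_le_of_equicontinuous hω ha h
      (gaborGS hω le_rfl zero_le_one) 1 0
    have h1 : |a|⁻¹ ≤ 1 := by
      refine hbdd _ B fun m => ?_
      have h2 := hB m (a ^ (m : ℕ))⁻¹
      rw [mul_inv_cancel₀ (pow_ne_zero _ ha), coe_gaborGS, iteratedDeriv_zero, pow_zero, one_smul,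
        norm_gabor_self, mul_one, pow_one, abs_inv, abs_pow, ← inv_pow] at h2
      exact h2
    exact (inv_le_one₀ ha0).1 h1

/-! ### The remaining implications -/

theorem equicontinuous_compIterateSchwartz {ω : ℝ → ℝ} (hω : IsWeightFunction ω) {a : ℝ}
    (ha : a ≠ 0) (h : IsPowerBounded (compDilation hω ha)) :
    Equicontinuous fun (m : ℕ+) (f : GelfandShilov ω) => compIterateSchwartz hω ha (m : ℕ) f := by
  intro f U hU
  have huc : UniformContinuous (toSchwartz ω) := (toSchwartz ω).uniformContinuous
  exact h f _ (huc hU)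

theorem compDilation_pow_eq {ω : ℝ → ℝ} (hω : IsWeightFunction ω) {a : ℝ} (ha : a ≠ 0)
    (h : a = 1 ∨ a = -1) (k : ℕ) :
    compDilation hω ha ^ k = if Even k then 1 else compDilation hω ha := by
  ext f
  refine DFunLike.ext _ _ fun x => ?_
  rw [coe_compDilation_pow]
  split_ifs with hk
  · rcases h with rfl | rfl <;> simp [hk.neg_one_pow]
  · rw [compDilation_apply]
    rcases h with rfl | rfl <;> simp [(Nat.not_even_iff_odd.1 hk).neg_one_pow]

theorem isPowerBounded_compDilation {ω : ℝ → ℝ} (hω : IsWeightFunction ω) {a : ℝ} (ha : a ≠ 0)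
    (h : a = 1 ∨ a = -1) : IsPowerBounded (compDilation hω ha) := by
  have hfin : Equicontinuous fun (b : Bool) (f : GelfandShilov ω) =>
      (if b then 1 else compDilation hω ha) f :=
    equicontinuous_finite.2 fun b => ContinuousLinearMap.continuous _
  have := hfin.comp fun k : ℕ+ => decide (Even (k : ℕ))
  unfold IsPowerBounded
  convert this using 3 with k f
  simp [compDilation_pow_eq hω ha h]

theorem isMTopologizable_compDilation {ω : ℝ → ℝ} (hω : IsWeightFunction ω) {a : ℝ}
    (ha : a ≠ 0) (h : a = 1 ∨ a = -1) : IsMTopologizable (compDilation hω ha) := by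
  intro p hp
  -- This seminorm dominates `p` after either of the two possible powers, so `C = 1` works.
  refine ⟨p + p.comp (compDilation hω ha).toLinearMap,
    hp.add (hp.comp (compDilation hω ha).continuous), 1, le_rfl, fun k f => ?_⟩
  rw [one_pow, one_mul, compDilation_pow_eq hω ha h]
  change _ ≤ p f + p (compDilation hω ha f)
  split_ifs
  · exact le_add_of_nonneg_right (apply_nonneg p _)
  · exact le_add_of_nonneg_left (apply_nonneg p _)

end GelfandShilov

theorem IsMTopologizable.isTopologizable {E : Type*} [AddCommGroup E] [Module ℂ E]
    [TopologicalSpace E] {T : E →L[ℂ] E} (h : IsMTopologizable T) : IsTopologizable T := by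
  intro p hp
  obtain ⟨q, hq, C, hC, hle⟩ := h p hp
  exact ⟨q, hq, fun k => ⟨C ^ (k : ℕ), by positivity, fun x => hle k x⟩⟩

theorem mainTheorem1 (ω : ℝ → ℝ) (hω : IsWeightFunction ω) (hζ : ConditionZeta ω)
    (a : ℝ) (ha : a ≠ 0) :
    List.TFAE
      [IsPowerBounded (GelfandShilov.compDilation hω ha),
       IsMTopologizable (GelfandShilov.compDilation hω ha),
       IsTopologizable (GelfandShilov.compDilation hω ha),
       Equicontinuous fun (m : ℕ+) (f : GelfandShilov ω) =>
         GelfandShilov.compIterateSchwartz hω ha (m : ℕ) f,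
       a = 1 ∨ a = -1] := by
  tfae_have 5 → 1 := GelfandShilov.isPowerBounded_compDilation hω ha
  tfae_have 5 → 2 := GelfandShilov.isMTopologizable_compDilation hω ha
  tfae_have 2 → 3 := IsMTopologizable.isTopologizable
  tfae_have 3 → 5 := fun h => eq_or_eq_neg_of_abs_eq
    (le_antisymm (GelfandShilov.abs_le_one_of_isTopologizable hω hζ ha h)
      (GelfandShilov.one_le_abs_of_isTopologizable hω hζ ha h))
  tfae_have 1 → 4 := GelfandShilov.equicontinuous_compIterateSchwartz hω ha
  tfae_have 4 → 5 := fun h => eq_or_eq_neg_of_abs_eq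
    (GelfandShilov.abs_eq_one_of_equicontinuous_compIterateSchwartz hω ha h)
  tfae_finish
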